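/- For a positive integer $k$, an integer $1\le j\le k+1$ and a real number $\zeta$, let $\lambda_{k,j}(\zeta)$ (respectively $\widehat\lambda_{k,j}(\zeta)$) denote the supremum in $[-\infty,\infty]$ of all $\eta\in\mathbb{R}$ for which the system \[ |x|\le X,\qquad \max_{1\le i\le k}|\zeta^{i}x-y_i|\le X^{-\eta} \] has at least $j$ linearly independent solutions $(x,y_1,\dots,y_k)\in\mathbb{Z}^{k+1}$ for arbitrarily large real $X$ (respectively for all real $X\ge X_0$, for some $X_0$). **Corollary.** Let $k$ be a positive integer and let $(a_l)_{l\ge 1}$ be a strictly increasing sequence of positive integers with \[ \limsup_{n\to\infty}\min\left\{\frac{a_{n+1}}{a_n},\frac{a_{n+2}}{a_{n+1}}\right\}=\infty . \] Let $b\ge 2$ be an integer and let $\zeta=\sum_{l\ge 1}b^{-a_l}$. Then \[ \lambda_{k,1}(\zeta)=\infty,\qquad \lambda_{k,j}(\zeta)=\frac{1}{j-1}\quad(2\le j\le k+1), \] \[ \widehat\lambda_{k,1}(\zeta)=\frac1k,\qquad \widehat\lambda_{k,j}(\zeta)=0\quad(2\le j\le k+1). \] -/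

import Mathlib

open Filter

/-- There are (at least) `j` linearly independent integer vectors `(x, y₁, …, y_k)` with
`|x| ≤ X` and `max_i |ζ_i x - y_i| ≤ X ^ (-η)`. The coordinate `v 0` is `x` and
`v i.succ` is the `y` paired with `ζ i`. -/
def HasIndepSolutions (k j : ℕ) (ζ : Fin k → ℝ) (η X : ℝ) : Prop :=
  ∃ v : Fin j → (Fin (k + 1) → ℤ), LinearIndependent ℤ v ∧
    ∀ s : Fin j, |((v s 0 : ℤ) : ℝ)| ≤ X ∧
      ∀ i : Fin k, |ζ i * ((v s 0 : ℤ) : ℝ) - ((v s i.succ : ℤ) : ℝ)| ≤ X ^ (-η)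

/-- The ordinary exponent of simultaneous approximation of a real vector: the supremum, in the
extended reals, of the real `η` such that the system is solvable for arbitrarily large `X`. -/
noncomputable def lambdaVec (k j : ℕ) (ζ : Fin k → ℝ) : EReal :=
  sSup ((fun η : ℝ => (η : EReal)) ''
    {η : ℝ | ∀ X₀ : ℝ, ∃ X : ℝ, X₀ ≤ X ∧ HasIndepSolutions k j ζ η X})

/-- The uniform exponent of simultaneous approximation of a real vector: the supremum, in the
extended reals, of the real `η` such that the system is solvable for all `X ≥ X₀`, for
some `X₀`. -/
noncomputable def lambdaHatVec (k j : ℕ) (ζ : Fin k → ℝ) : EReal :=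
  sSup ((fun η : ℝ => (η : EReal)) ''
    {η : ℝ | ∃ X₀ : ℝ, ∀ X : ℝ, X₀ ≤ X → HasIndepSolutions k j ζ η X})

/-- The vector `(ζ, ζ ^ 2, …, ζ ^ k)`. -/
noncomputable def powerVec (k : ℕ) (ζ : ℝ) : Fin k → ℝ := fun i => ζ ^ ((i : ℕ) + 1)

/-- The ordinary exponent of the successive powers of `ζ`. -/
noncomputable def lambdaExp (k j : ℕ) (ζ : ℝ) : EReal := lambdaVec k j (powerVec k ζ)

/-- The uniform exponent of the successive powers of `ζ`. -/
noncomputable def lambdaHatExp (k j : ℕ) (ζ : ℝ) : EReal := lambdaHatVec k j (powerVec k ζ)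

/-! Ordinary exponents, upper bound: `m + 1` independent solutions have a nonzero integer maximal
minor. Their matrix is within `X ^ (-η)` of a rank-one matrix, so that minor is `O(X ^ (1 - η m))`,
which forces `η ≤ 1 / m` for every real vector (`HasIndepSolutions.rpow_le`, `lambdaVec_le`).

Ordinary exponents, lower bound: along indices where both ratios are large, `ζ` is extremely close
to `p / q + 1 / Q` with `q = b ^ a n`, `Q = b ^ a (n + 1)`. Keeping the integral terms of `q ^ k * Q
^ r * (p / q + 1 / Q) ^ i` gives, for `r = 0, …, m`, independent vectors of height at most `q ^ k *
Q ^ m` and error about `q ^ k / Q`. As `q` is negligible against `Q`, every `η < 1 / m` is reached,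
and every `η` if `m = 0` (`le_lambdaExp`).

Uniform exponents, upper bounds: a large gap between `a n` and `a (n + 1)` contains heights `X` at
which every good solution is a geometric progression of ratio `p / q` (`mul_pow_eq_of_approx`). Two
solutions are then proportional, so the exponents with `j ≥ 2` are at most `0`. Since `p` is prime
to `b`, also `q ^ k ∣ x`, so there is no nonzero solution just below `q ^ k`, which gives `1 / k`
for `j = 1`. The matching lower bounds hold for all vectors, by Dirichlet's theorem and by integer
parts. -/

/-! ### Upper bound for the ordinary exponents, by determinants -/

/-- Linearly independent integer rows have a nonvanishing maximal minor. -/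
theorem exists_det_submatrix_ne_zero {j n : ℕ} (v : Fin j → Fin n → ℤ)
    (hv : LinearIndependent ℤ v) :
    ∃ f : Fin j → Fin n, ((Matrix.of v).submatrix id f).det ≠ 0 := by
  let M : Matrix (Fin j) (Fin n) ℚ := (Matrix.of v).map (Int.castRingHom ℚ)
  have hM : LinearIndependent ℚ M.row := by
    rw [← LinearIndependent.iff_fractionRing ℤ ℚ]
    let g : (Fin n → ℤ) →ₗ[ℤ] (Fin n → ℚ) := (Algebra.linearMap ℤ ℚ).compLeft (Fin n)
    have hg : LinearMap.ker g = ⊥ := by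
      rw [LinearMap.ker_eq_bot]
      intro x y h
      ext i
      simpa [g] using congrFun h i
    exact hv.map' g hg
  have hr := hM.rank_matrix
  rw [Matrix.rank_eq_finrank_span_cols, Fintype.card_fin] at hr
  obtain ⟨κ, f, hf, hsp, hli⟩ := exists_linearIndependent' ℚ M.col
  have : Finite κ := Finite.of_injective f hf
  have : Fintype κ := Fintype.ofFinite κ
  rw [← hsp] at hr
  have hc : Fintype.card κ = Fintype.card (Fin j) := by
    rw [linearIndependent_iff_card_eq_finrank_span.mp hli, Set.finrank, hr, Fintype.card_fin]
  let e : Fin j ≃ κ := (Fintype.equivOfCardEq hc).symm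
  refine ⟨f ∘ e, fun h0 => ?_⟩
  have h1 : LinearIndependent ℚ (M.submatrix id (f ∘ e)).col := hli.comp e e.injective
  rw [Matrix.linearIndependent_cols_iff_isUnit, Matrix.isUnit_iff_isUnit_det] at h1
  apply h1.ne_zero
  have h2 := congrArg (Int.castRingHom ℚ) h0
  rw [RingHom.map_det] at h2
  simpa [M, Matrix.submatrix_map] using h2

/-- A determinant bound for matrices close to a matrix of rank one. -/
theorem abs_det_sub_mul_le {j : ℕ} (x c : Fin j → ℝ) (ε : Matrix (Fin j) (Fin j) ℝ) {C X δ : ℝ}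
    (hC : 1 ≤ C) (hX : 1 ≤ X) (hδ : 0 < δ) (hδ1 : δ ≤ 1) (hc : ∀ i, |c i| ≤ C)
    (hx : ∀ s, |x s| ≤ X) (hε : ∀ s i, |ε s i| ≤ δ) :
    X⁻¹ * δ * (δ⁻¹) ^ j * |(Matrix.of fun s i => x s * c i - ε s i).det|
      ≤ (j + 1).factorial * C ^ (j + 1) := by
  -- Bordering by `1`, `c`, `x` turns the rank-one perturbation into a Schur complement, with the
  -- same determinant up to sign.
  let N : Matrix (Unit ⊕ Fin j) (Unit ⊕ Fin j) ℝ :=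
    Matrix.fromBlocks 1 (Matrix.of fun _ i => c i) (Matrix.of fun s _ => x s) ε
  have hN : |N.det| = |(Matrix.of fun s i => x s * c i - ε s i).det| := by
    have h1 : (Matrix.of fun s i => x s * c i - ε s i) =
        -(ε - (Matrix.of fun s (_ : Unit) => x s) * (Matrix.of fun (_ : Unit) i => c i)) := by
      ext s i
      simp [Matrix.mul_apply]
    rw [Matrix.det_fromBlocks_one₁₁, h1, Matrix.det_neg, abs_mul, abs_pow]
    simp
  -- Column weights `X⁻¹`, `δ⁻¹` and row weight `δ` on the border bring all entries below `C`; their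
  -- product is the factor in the claim.
  let u : Unit ⊕ Fin j → ℝ := Sum.elim (fun _ => X⁻¹) (fun _ => δ⁻¹)
  let w : Unit ⊕ Fin j → ℝ := Sum.elim (fun _ => δ) (fun _ => 1)
  let N₁ : Matrix (Unit ⊕ Fin j) (Unit ⊕ Fin j) ℝ := Matrix.of fun a a' => u a' * N a a'
  let N₂ : Matrix (Unit ⊕ Fin j) (Unit ⊕ Fin j) ℝ := Matrix.of fun a a' => w a * N₁ a a'
  have hX0 : 0 < X := by linarith
  have hdet : |N₂.det| = X⁻¹ * δ * (δ⁻¹) ^ j * |N.det| := by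
    rw [Matrix.det_mul_column, Matrix.det_mul_row]
    simp only [Fintype.prod_sum_type, u, w, Sum.elim_inl, Sum.elim_inr, Finset.univ_unique,
      Finset.prod_const, Finset.card_singleton, pow_one, Finset.card_univ, Fintype.card_fin, one_pow,
      mul_one, abs_mul, abs_pow, abs_inv, abs_of_pos hX0, abs_of_pos hδ]
    ring
  have hle : ∀ a a', |N₂ a a'| ≤ C := by
    rintro (a | s) (a' | i)
    · have : |δ * (X⁻¹ * 1)| ≤ 1 := by
        rw [mul_one, abs_of_pos (by positivity)]
        exact mul_le_one₀ hδ1 (by positivity) (inv_le_one_of_one_le₀ hX)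
      simpa [N₂, N₁, N, u, w] using this.trans hC
    · have : |δ * (δ⁻¹ * c i)| ≤ C := by
        rw [mul_inv_cancel_left₀ hδ.ne']
        exact hc i
      simpa [N₂, N₁, N, u, w] using this
    · have : |X⁻¹ * x s| ≤ 1 := by
        rw [abs_mul, abs_inv, abs_of_pos hX0]
        exact (inv_mul_le_one₀ hX0).2 (hx s)
      simpa [N₂, N₁, N, u, w] using this.trans hC
    · have : |δ⁻¹ * ε s i| ≤ 1 := by
        rw [abs_mul, abs_inv, abs_of_pos hδ]
        exact (inv_mul_le_one₀ hδ).2 (hε s i)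
      simpa [N₂, N₁, N, u, w] using this.trans hC
  have h := Matrix.det_le (abv := AbsoluteValue.abs) (A := N₂) hle
  rw [AbsoluteValue.abs_apply, hdet, hN] at h
  simpa [add_comm] using h

/-- If `j = m + 1` independent solutions exist then `X ^ (η m - 1)` is bounded. -/
theorem HasIndepSolutions.rpow_le {k m : ℕ} {ζ : Fin k → ℝ} {η X C : ℝ} (hη : 0 ≤ η)
    (hX : 1 ≤ X) (hC : 1 ≤ C) (hζ : ∀ i, |ζ i| ≤ C) (h : HasIndepSolutions k (m + 1) ζ η X) :
    X ^ (η * m - 1) ≤ (m + 2).factorial * C ^ (m + 2) := by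
  obtain ⟨v, hv, hs⟩ := h
  obtain ⟨f, hf⟩ := exists_det_submatrix_ne_zero v hv
  have hX0 : 0 < X := by linarith
  have hδ : 0 < X ^ (-η) := by positivity
  -- With `c 0 = 1` the coordinate `x` is approximated with error zero, so minors using column `0`
  -- need no separate case.
  let c : Fin (k + 1) → ℝ := Fin.cons 1 ζ
  let E : Fin (m + 1) → Fin (k + 1) → ℝ := fun s i => (v s 0 : ℝ) * c i - v s i
  have h1 := abs_det_sub_mul_le (j := m + 1) (fun s => (v s 0 : ℝ)) (c ∘ f)
    (Matrix.of fun s i => E s (f i)) hC hX hδ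
    (Real.rpow_le_one_of_one_le_of_nonpos hX (by linarith))
    (fun i => by
      have : ∀ i, |c i| ≤ C := by
        intro i
        refine Fin.cases ?_ ?_ i
        · simpa [c] using hC
        · simpa [c] using hζ
      exact this _)
    (fun s => (hs s).1)
    (fun s i => by
      have : ∀ i, |E s i| ≤ X ^ (-η) := by
        intro i
        refine Fin.cases ?_ ?_ i
        · simpa [c, E] using hδ.le
        · intro i
          have := (hs s).2 i
          simpa [c, E, mul_comm] using this
      exact this _)
  have h2 : 1 ≤ |(Matrix.of fun s i => (v s 0 : ℝ) * (c ∘ f) i -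
      (Matrix.of fun s i => E s (f i)) s i).det| := by
    have h3 : (Matrix.of fun s i => (v s 0 : ℝ) * (c ∘ f) i -
        (Matrix.of fun s i => E s (f i)) s i) =
        ((Matrix.of v).submatrix id f).map (Int.castRingHom ℝ) := by
      ext s i
      simp [E]
    rw [h3, ← RingHom.mapMatrix_apply, ← RingHom.map_det]
    simpa using (mod_cast Int.one_le_abs hf :
      (1 : ℝ) ≤ ((|((Matrix.of v).submatrix id f).det| : ℤ) : ℝ))
  have h4 : X ^ (η * m - 1) = X⁻¹ * X ^ (-η) * ((X ^ (-η))⁻¹) ^ (m + 1) := by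
    rw [pow_succ', mul_assoc, mul_inv_cancel_left₀ hδ.ne', Real.rpow_neg hX0.le, inv_inv,
      ← Real.rpow_mul_natCast hX0.le, Real.rpow_sub hX0, Real.rpow_one]
    ring
  rw [h4]
  exact (le_mul_of_one_le_right (by positivity) h2).trans h1

theorem lambdaVec_le (k m : ℕ) (hm : 1 ≤ m) (ζ : Fin k → ℝ) :
    lambdaVec k (m + 1) ζ ≤ ((1 / (m : ℝ) : ℝ) : EReal) := by
  refine sSup_le ?_
  rintro _ ⟨η, hη, rfl⟩
  rw [EReal.coe_le_coe_iff]
  by_contra! hlt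
  have hm0 : (0 : ℝ) < m := by exact_mod_cast hm
  have hη0 : 0 < η := lt_trans (by positivity) hlt
  have hpos : 0 < η * m - 1 := by
    rw [div_lt_iff₀ hm0] at hlt
    linarith
  let C : ℝ := 1 + ∑ i, |ζ i|
  have hS : ∀ i, |ζ i| ≤ ∑ i, |ζ i| := fun i =>
    Finset.single_le_sum (f := fun i => |ζ i|) (fun _ _ => abs_nonneg _) (Finset.mem_univ i)
  have hC : 1 ≤ C := by
    have : 0 ≤ ∑ i, |ζ i| := Finset.sum_nonneg fun _ _ => abs_nonneg _
    simp only [C]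
    linarith
  have hev := (tendsto_rpow_atTop hpos).eventually_gt_atTop
    (((m + 2).factorial : ℝ) * C ^ (m + 2))
  obtain ⟨X₀, hX₀⟩ := eventually_atTop.1 hev
  obtain ⟨X, hX, hsol⟩ := hη (max X₀ 1)
  refine absurd (hsol.rpow_le hη0.le ((le_max_right _ _).trans hX) hC fun i => ?_)
    (not_le.2 (hX₀ X ((le_max_left _ _).trans hX)))
  have := hS i
  simp only [C]
  linarith

/-! ### Lower bounds for the uniform exponents of any vector -/

/-- Dirichlet's theorem on simultaneous approximation. -/
theorem exists_simultaneous_approx {k : ℕ} (ζ : Fin k → ℝ) {Q : ℕ} (hQ : 1 ≤ Q) :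
    ∃ v : Fin (k + 1) → ℤ, v ≠ 0 ∧ |((v 0 : ℤ) : ℝ)| ≤ (Q : ℝ) ^ k ∧
      ∀ i : Fin k, |ζ i * (v 0 : ℝ) - (v i.succ : ℝ)| ≤ (Q : ℝ)⁻¹ := by
  have hQ0 : (0 : ℝ) < Q := by exact_mod_cast hQ
  -- Pigeonhole: `Q ^ k + 1` multiples fall into `Q ^ k` boxes of side `1 / Q`.
  let F : Fin (Q ^ k + 1) → Fin k → Fin Q := fun x i =>
    ⟨⌊(Q : ℝ) * Int.fract (ζ i * (x : ℕ))⌋₊, by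
      rw [Nat.floor_lt (by positivity)]
      exact mul_lt_of_lt_one_right hQ0 (Int.fract_lt_one _)⟩
  obtain ⟨x, x', hne, hF⟩ := Fintype.exists_ne_map_eq_of_card_lt F (by simp)
  refine ⟨Fin.cons ((x : ℤ) - (x' : ℤ))
    (fun i => ⌊ζ i * ((x : ℕ) : ℝ)⌋ - ⌊ζ i * ((x' : ℕ) : ℝ)⌋), ?_, ?_, ?_⟩
  · intro h
    apply hne
    have := congrFun h 0
    simp only [Fin.cons_zero, Pi.zero_apply] at this
    exact Fin.ext (by omega)
  · have h : |(x : ℤ) - (x' : ℤ)| ≤ ((Q ^ k : ℕ) : ℤ) := by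
      rw [abs_le]
      omega
    simp only [Fin.cons_zero]
    exact_mod_cast h
  · intro i
    have h1 : ⌊(Q : ℝ) * Int.fract (ζ i * ((x : ℕ) : ℝ))⌋₊ =
        ⌊(Q : ℝ) * Int.fract (ζ i * ((x' : ℕ) : ℝ))⌋₊ := congrArg Fin.val (congrFun hF i)
    have e1 := Nat.floor_le (a := (Q : ℝ) * Int.fract (ζ i * ((x : ℕ) : ℝ))) (by positivity)
    have e2 := Nat.lt_floor_add_one ((Q : ℝ) * Int.fract (ζ i * ((x : ℕ) : ℝ)))
    have e3 := Nat.floor_le (a := (Q : ℝ) * Int.fract (ζ i * ((x' : ℕ) : ℝ))) (by positivity)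
    have e4 := Nat.lt_floor_add_one ((Q : ℝ) * Int.fract (ζ i * ((x' : ℕ) : ℝ)))
    rw [h1] at e1 e2
    have h2 : |(Q : ℝ) * (Int.fract (ζ i * ((x : ℕ) : ℝ)) -
        Int.fract (ζ i * ((x' : ℕ) : ℝ)))| ≤ 1 := by
      rw [abs_le]
      constructor <;> linarith
    rw [abs_mul, abs_of_pos hQ0] at h2
    have h3 : ζ i * (((x : ℤ) - (x' : ℤ) : ℤ) : ℝ) -
        ((⌊ζ i * ((x : ℕ) : ℝ)⌋ - ⌊ζ i * ((x' : ℕ) : ℝ)⌋ : ℤ) : ℝ) =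
        Int.fract (ζ i * ((x : ℕ) : ℝ)) - Int.fract (ζ i * ((x' : ℕ) : ℝ)) := by
      simp only [Int.fract]
      push_cast
      ring
    simp only [Fin.cons_zero, Fin.cons_succ]
    rw [h3, ← one_div, le_div_iff₀ hQ0, mul_comm]
    exact h2

theorem hasIndepSolutions_one {k : ℕ} {ζ : Fin k → ℝ} {η X : ℝ} (v : Fin (k + 1) → ℤ)
    (hv : v ≠ 0) (hX : |((v 0 : ℤ) : ℝ)| ≤ X)
    (h : ∀ i : Fin k, |ζ i * (v 0 : ℝ) - (v i.succ : ℝ)| ≤ X ^ (-η)) :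
    HasIndepSolutions k 1 ζ η X :=
  ⟨fun _ => v, linearIndependent_unique_iff.2 hv, fun _ => ⟨hX, h⟩⟩

/-- Dirichlet with `Q = ⌈X ^ η⌉`: the height `Q ^ k ≤ 2 ^ k * X ^ (η k)` is below `X` for large `X`,
because `η k < 1`. -/
theorem le_lambdaHatVec_one {k : ℕ} (hk : 1 ≤ k) (ζ : Fin k → ℝ) :
    ((1 / (k : ℝ) : ℝ) : EReal) ≤ lambdaHatVec k 1 ζ := by
  have hk0 : (0 : ℝ) < k := by exact_mod_cast hk
  have key : ∀ η : ℝ, 0 < η → η < 1 / (k : ℝ) → (η : EReal) ≤ lambdaHatVec k 1 ζ := by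
    intro η hη hlt
    refine le_sSup ⟨η, ?_, rfl⟩
    have hpos : 0 < 1 - η * k := by
      rw [lt_div_iff₀ hk0] at hlt
      linarith
    obtain ⟨X₀, hX₀⟩ := eventually_atTop.1
      ((tendsto_rpow_atTop hpos).eventually_ge_atTop ((2 : ℝ) ^ k))
    refine ⟨max X₀ 1, fun X hX => ?_⟩
    have hX1 : 1 ≤ X := (le_max_right _ _).trans hX
    have hX0 : 0 < X := by linarith
    have h1 : (1 : ℝ) ≤ X ^ η := Real.one_le_rpow hX1 hη.le
    have hQ : 1 ≤ ⌈X ^ η⌉₊ := Nat.one_le_ceil_iff.2 (by linarith)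
    obtain ⟨v, hv, hv0, hvi⟩ := exists_simultaneous_approx ζ hQ
    refine hasIndepSolutions_one v hv (hv0.trans ?_) fun i => (hvi i).trans ?_
    · have h2 : (⌈X ^ η⌉₊ : ℝ) ≤ 2 * X ^ η := by
        have := Nat.ceil_lt_add_one (show 0 ≤ X ^ η by positivity)
        linarith
      calc (⌈X ^ η⌉₊ : ℝ) ^ k ≤ (2 * X ^ η) ^ k := by gcongr
        _ = 2 ^ k * X ^ (η * k) := by rw [mul_pow, Real.rpow_mul_natCast hX0.le]
        _ ≤ X ^ (1 - η * k) * X ^ (η * k) := by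
          gcongr
          exact hX₀ X ((le_max_left _ _).trans hX)
        _ = X := by rw [← Real.rpow_add hX0]; simp
    · rw [Real.rpow_neg hX0.le]
      gcongr
      exact Nat.le_ceil _
  refine EReal.ge_of_forall_gt_iff_ge.1 fun c hc => ?_
  rw [EReal.coe_lt_coe_iff] at hc
  obtain ⟨η, h1, h2⟩ := exists_between (max_lt hc (show 0 < 1 / (k : ℝ) by positivity))
  exact (EReal.coe_le_coe_iff.2 ((le_max_left _ _).trans h1.le)).trans
    (key η ((le_max_right _ _).trans_lt h1) h2)

/-- The vector `(1, ⌊ζ₁⌋, …, ⌊ζ_k⌋)` and the unit vectors of the `y` coordinates have errors at most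
`1 = X ^ 0`. -/
theorem lambdaHatVec_nonneg {k j : ℕ} (hj : j ≤ k + 1) (ζ : Fin k → ℝ) :
    0 ≤ lambdaHatVec k j ζ := by
  refine le_sSup ⟨0, ⟨1, fun X hX => ?_⟩, rfl⟩
  let V : Matrix (Fin (k + 1)) (Fin (k + 1)) ℤ :=
    Matrix.of fun s i => if s = i then 1 else if s = 0 then
      (Fin.cons 1 (fun t => ⌊ζ t⌋) : Fin (k + 1) → ℤ) i else 0
  have hdet : V.det = 1 := by
    rw [Matrix.det_of_isUpperTriangular]
    · simp [V]
    · intro s i h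
      have h' : i < s := h
      have h1 : s ≠ i := h'.ne'
      have h2 : s ≠ 0 := (lt_of_le_of_lt (Fin.zero_le i) h').ne'
      simp [V, h1, h2]
  have hV : LinearIndependent ℤ V.row :=
    Matrix.linearIndependent_rows_of_isUnit ((Matrix.isUnit_iff_isUnit_det _).2 (by simp [hdet]))
  have hrow : ∀ s : Fin (k + 1), |((V s 0 : ℤ) : ℝ)| ≤ X ∧
      ∀ i : Fin k, |ζ i * ((V s 0 : ℤ) : ℝ) - ((V s i.succ : ℤ) : ℝ)| ≤ X ^ (-(0 : ℝ)) := by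
    refine Fin.cases ?_ fun t => ?_
    · refine ⟨by simpa [V] using hX, fun i => ?_⟩
      have h0 : (0 : Fin (k + 1)) ≠ i.succ := (Fin.succ_ne_zero i).symm
      simp only [V, Matrix.of_apply, h0, if_true, if_false, Fin.cons_succ, neg_zero,
        Real.rpow_zero, Int.cast_one, mul_one]
      rw [abs_le]
      constructor <;> linarith [Int.floor_le (ζ i), Int.lt_floor_add_one (ζ i)]
    · have h0 : t.succ ≠ 0 := Fin.succ_ne_zero t
      refine ⟨by simpa [V, h0] using zero_le_one.trans hX, fun i => ?_⟩
      by_cases h : t = i <;> simp [V, h]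
  exact ⟨fun s => V.row (Fin.castLE hj s), hV.comp _ (Fin.castLE_injective hj),
    fun s => hrow _⟩

/-! ### Rigidity of approximations near a rational number -/

theorem pow_sub_pow_le_mul_sub {z ζ : ℝ} (hz : 0 ≤ z) (hzζ : z ≤ ζ) (hζ : ζ ≤ 1) (e : ℕ) :
    ζ ^ e - z ^ e ≤ e * (ζ - z) := by
  induction e with
  | zero => simp
  | succ e ih =>
    have h1 : ζ ^ (e + 1) - z ^ (e + 1) = ζ * (ζ ^ e - z ^ e) + z ^ e * (ζ - z) := by ring
    have h2 : 0 ≤ ζ ^ e - z ^ e := sub_nonneg.2 (pow_le_pow_left₀ hz hzζ e)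
    have h3 : z ^ e ≤ 1 := pow_le_one₀ hz (hzζ.trans hζ)
    have h4 : ζ * (ζ ^ e - z ^ e) ≤ ζ ^ e - z ^ e := mul_le_of_le_one_left h2 hζ
    have h5 : z ^ e * (ζ - z) ≤ ζ - z := mul_le_of_le_one_left (by linarith) h3
    rw [h1]
    push_cast
    linarith

theorem two_mul_le_two_pow {k : ℕ} (hk : 1 ≤ k) : 2 * k ≤ 2 ^ k := by
  obtain ⟨m, rfl⟩ : ∃ m, k = m + 1 := ⟨k - 1, by omega⟩
  have := Nat.lt_two_pow_self (n := m)
  rw [pow_succ]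
  omega

/-- If `ζ` is very close to `p / b ^ A`, then all good approximations to `(ζ, …, ζ ^ k)` at the
level `b ^ C` are proportional to the powers of `p / b ^ A`. -/
theorem mul_pow_eq_of_approx {k b A B C p : ℕ} (hk : 1 ≤ k) (hb : 2 ≤ b) {ζ η : ℝ}
    (hζ : ζ ≤ 1) (h1 : (p : ℝ) / (b : ℝ) ^ A ≤ ζ)
    (h2 : ζ - (p : ℝ) / (b : ℝ) ^ A ≤ 2 * ((b : ℝ) ^ B)⁻¹)
    (hC : (A + 3 : ℝ) ≤ η * C) (hB : C + A + k + 3 ≤ B) {v : Fin (k + 1) → ℤ}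
    (hx : |(v 0 : ℝ)| ≤ (b : ℝ) ^ C)
    (hy : ∀ i : Fin k, |powerVec k ζ i * (v 0 : ℝ) - (v i.succ : ℝ)| ≤ ((b : ℝ) ^ C) ^ (-η))
    (i : Fin (k + 1)) :
    v 0 * (p : ℤ) ^ (i : ℕ) = ((b : ℤ) ^ A) ^ (i : ℕ) * v i := by
  have hb1 : (1 : ℝ) ≤ b := by exact_mod_cast (by omega : 1 ≤ b)
  have hb2 : (2 : ℝ) ≤ b := by exact_mod_cast hb
  have hb0 : (0 : ℝ) < b := by linarith
  have hbA : (0 : ℝ) < (b : ℝ) ^ A := by positivity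
  set z : ℝ := (p : ℝ) / (b : ℝ) ^ A with hz
  have hz0 : 0 ≤ z := by positivity
  have hz1 : z ≤ 1 := h1.trans hζ
  have hpow : 2 * (k : ℝ) ≤ (b : ℝ) ^ k := by
    have : ((2 * k : ℕ) : ℝ) ≤ ((2 ^ k : ℕ) : ℝ) := by exact_mod_cast two_mul_le_two_pow hk
    push_cast at this
    exact this.trans (by gcongr)
  have e1 : ((b : ℝ) ^ C) ^ (-η) ≤ ((b : ℝ) ^ (A + 3))⁻¹ := by
    rw [← Real.rpow_natCast b C, ← Real.rpow_mul hb0.le, ← Real.rpow_natCast b (A + 3),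
      ← Real.rpow_neg hb0.le]
    apply Real.rpow_le_rpow_of_exponent_le hb1
    push_cast
    linarith
  have e2 : ∀ e ≤ k, |(ζ ^ e - z ^ e) * (v 0 : ℝ)| ≤ ((b : ℝ) ^ (A + 3))⁻¹ := by
    intro e he
    have h3 := pow_sub_pow_le_mul_sub hz0 h1 hζ e
    have h4 : 0 ≤ ζ ^ e - z ^ e := sub_nonneg.2 (pow_le_pow_left₀ hz0 h1 e)
    have h5 : (e : ℝ) ≤ k := by exact_mod_cast he
    rw [abs_mul, abs_of_nonneg h4]
    calc (ζ ^ e - z ^ e) * |(v 0 : ℝ)| ≤ (k * (2 * ((b : ℝ) ^ B)⁻¹)) * (b : ℝ) ^ C := by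
          refine mul_le_mul (h3.trans ?_) hx (abs_nonneg _) (by positivity)
          exact mul_le_mul h5 h2 (by linarith) (by positivity)
      _ = 2 * k * (b : ℝ) ^ C / (b : ℝ) ^ B := by ring
      _ ≤ (b : ℝ) ^ k * (b : ℝ) ^ C / (b : ℝ) ^ (C + A + k + 3) := by gcongr
      _ = ((b : ℝ) ^ (A + 3))⁻¹ := by
          rw [show C + A + k + 3 = k + C + (A + 3) by ring, pow_add _ (k + C), pow_add]
          field_simp
  have e3 : ∀ i : Fin (k + 1), |z ^ (i : ℕ) * (v 0 : ℝ) - (v i : ℝ)| ≤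
      2 * ((b : ℝ) ^ (A + 3))⁻¹ := by
    refine Fin.cases (by simp) fun i => ?_
    have h3 : z ^ (i.succ : ℕ) * (v 0 : ℝ) - (v i.succ : ℝ) =
        (powerVec k ζ i * (v 0 : ℝ) - (v i.succ : ℝ)) -
          (ζ ^ ((i : ℕ) + 1) - z ^ ((i : ℕ) + 1)) * (v 0 : ℝ) := by
      rw [powerVec, Fin.val_succ]
      ring
    rw [h3]
    have := abs_sub (powerVec k ζ i * (v 0 : ℝ) - (v i.succ : ℝ))
      ((ζ ^ ((i : ℕ) + 1) - z ^ ((i : ℕ) + 1)) * (v 0 : ℝ))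
    linarith [hy i, e2 ((i : ℕ) + 1) i.2]
  -- The difference is an integer of size at most `b ^ A * 4 / b ^ (A + 3) ≤ 1 / 2`, hence zero; the
  -- `3` in `hC` and `hB` provides this margin.
  have e4 : ∀ i : Fin k, (p : ℤ) * v i.castSucc = (b : ℤ) ^ A * v i.succ := by
    intro i
    have h3 : (((p : ℤ) * v i.castSucc - (b : ℤ) ^ A * v i.succ : ℤ) : ℝ) =
        (b : ℝ) ^ A * ((z ^ (i.succ : ℕ) * (v 0 : ℝ) - (v i.succ : ℝ)) -
          z * (z ^ (i.castSucc : ℕ) * (v 0 : ℝ) - (v i.castSucc : ℝ))) := by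
      have h4 : (p : ℝ) = (b : ℝ) ^ A * z := by
        rw [hz]
        field_simp
      push_cast
      rw [h4, Fin.val_succ, Fin.val_castSucc]
      ring
    have h5 : |z * (z ^ (i.castSucc : ℕ) * (v 0 : ℝ) - (v i.castSucc : ℝ))| ≤
        2 * ((b : ℝ) ^ (A + 3))⁻¹ := by
      rw [abs_mul, abs_of_nonneg hz0]
      exact (mul_le_of_le_one_left (abs_nonneg _) hz1).trans (e3 _)
    have h6 : |(((p : ℤ) * v i.castSucc - (b : ℤ) ^ A * v i.succ : ℤ) : ℝ)| < 1 := by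
      rw [h3, abs_mul, abs_of_pos hbA]
      calc _ ≤ (b : ℝ) ^ A * (4 * ((b : ℝ) ^ (A + 3))⁻¹) := by
            gcongr
            refine (abs_sub _ _).trans ?_
            linarith [e3 i.succ]
        _ = 4 / (b : ℝ) ^ 3 := by
            rw [pow_add]
            field_simp
        _ ≤ 4 / 2 ^ 3 := by gcongr
        _ < 1 := by norm_num
    have h7 : |(p : ℤ) * v i.castSucc - (b : ℤ) ^ A * v i.succ| < 1 := by exact_mod_cast h6
    rw [Int.abs_lt_one_iff] at h7
    linarith
  induction i using Fin.induction with
  | zero => simp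
  | succ i ih =>
    rw [Fin.val_castSucc] at ih
    rw [Fin.val_succ, pow_succ, pow_succ]
    linear_combination (p : ℤ) * ih + ((b : ℤ) ^ A) ^ (i : ℕ) * e4 i

/-! ### Independent approximations from truncated binomial expansions -/

/-- The integer vectors obtained by truncating the binomial expansions of
`q ^ k * Q ^ r * (p / q + 1 / Q) ^ i` to integral terms. -/
def truncBinomMatrix (k q Q p : ℕ) : Matrix (Fin (k + 1)) (Fin (k + 1)) ℤ :=
  (Matrix.of fun r t : Fin (k + 1) => if (t : ℕ) ≤ r then (Q : ℤ) ^ ((r : ℕ) - t) else 0) *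
    Matrix.of fun t i : Fin (k + 1) =>
      (((i : ℕ).choose t : ℕ) : ℤ) * q ^ (k + t - i) * p ^ ((i : ℕ) - t)

theorem truncBinomMatrix_apply (k q Q p : ℕ) (r i : Fin (k + 1)) :
    truncBinomMatrix k q Q p r i = ∑ t ∈ Finset.range (k + 1),
      (if t ≤ (r : ℕ) then (Q : ℤ) ^ ((r : ℕ) - t) else 0) *
        ((((i : ℕ).choose t : ℕ) : ℤ) * q ^ (k + t - i) * p ^ ((i : ℕ) - t)) := by
  rw [truncBinomMatrix, Matrix.mul_apply, Finset.sum_range]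
  rfl

theorem truncBinomMatrix_zero (k q Q p : ℕ) (r : Fin (k + 1)) :
    truncBinomMatrix k q Q p r 0 = q ^ k * Q ^ (r : ℕ) := by
  rw [truncBinomMatrix_apply, Finset.sum_eq_single 0]
  · simp [mul_comm]
  · intro t _ ht
    obtain ⟨u, rfl⟩ := Nat.exists_eq_succ_of_ne_zero ht
    simp
  · simp

/-- The factors are triangular, with diagonal entries `1` and `q ^ k`. -/
theorem linearIndependent_truncBinomMatrix {k q : ℕ} (Q p : ℕ) (hq : q ≠ 0) :
    LinearIndependent ℤ (truncBinomMatrix k q Q p).row := by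
  have hdet : (truncBinomMatrix k q Q p).det ≠ 0 := by
    rw [truncBinomMatrix, Matrix.det_mul, Matrix.det_of_isLowerTriangular,
      Matrix.det_of_isUpperTriangular]
    · simp [hq]
    · intro t i h
      have h' : (i : ℕ) < t := h
      simp [Nat.choose_eq_zero_of_lt h']
    · intro r t h
      have h' : ¬ t ≤ r := not_le.2 h
      simp [h']
  exact Matrix.linearIndependent_rows_of_det_ne_zero hdet

/-- Only the terms with `t > r` are dropped. Each carries `Q ^ (r - t) ≤ 1 / Q` and at most `q ^ k`
from the powers of `p` and `q`; the binomial coefficients sum to at most `2 ^ k`. -/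
theorem abs_truncBinomMatrix_sub_le {k q Q p : ℕ} (hq : 1 ≤ q) (hQ : 1 ≤ Q) (hp : p ≤ q)
    (r i : Fin (k + 1)) :
    |((p : ℝ) / q + 1 / Q) ^ (i : ℕ) * ((q : ℝ) ^ k * (Q : ℝ) ^ (r : ℕ)) -
      (truncBinomMatrix k q Q p r i : ℝ)| ≤ 2 ^ k * (q : ℝ) ^ k / Q := by
  have hq0 : (0 : ℝ) < q := by exact_mod_cast hq
  have hQ0 : (0 : ℝ) < Q := by exact_mod_cast hQ
  have hQ1 : (1 : ℝ) ≤ Q := by exact_mod_cast hQ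
  have hpq : (p : ℝ) ≤ q := by exact_mod_cast hp
  have hik : (i : ℕ) ≤ k := by omega
  have hext : ∀ f : ℕ → ℝ, (∀ t, (i : ℕ) < t → f t = 0) →
      ∑ t ∈ Finset.range ((i : ℕ) + 1), f t = ∑ t ∈ Finset.range (k + 1), f t := by
    intro f hf
    refine Finset.sum_subset (by simpa using hik) fun t _ ht => hf t ?_
    simpa [Nat.lt_succ_iff] using ht
  have h1 : ((p : ℝ) / q + 1 / Q) ^ (i : ℕ) * ((q : ℝ) ^ k * (Q : ℝ) ^ (r : ℕ)) =
      ∑ t ∈ Finset.range (k + 1),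
        (Q : ℝ) ^ (r : ℕ) / (Q : ℝ) ^ t *
          (((i : ℕ).choose t : ℝ) * q ^ (k + t - i) * p ^ ((i : ℕ) - t)) := by
    rw [← hext _ (fun t ht => by simp [Nat.choose_eq_zero_of_lt ht]), add_comm, add_pow,
      Finset.sum_mul]
    refine Finset.sum_congr rfl fun t ht => ?_
    have hti : t ≤ i := by simpa [Nat.lt_succ_iff] using ht
    have e : (q : ℝ) ^ k = q ^ (k + t - i) * q ^ ((i : ℕ) - t) := by
      rw [← pow_add]
      congr 1
      omega
    rw [e, div_pow, div_pow, one_pow]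
    field_simp
  have h2 : (truncBinomMatrix k q Q p r i : ℝ) = ∑ t ∈ Finset.range (k + 1),
      (if t ≤ (r : ℕ) then (Q : ℝ) ^ ((r : ℕ) - t) else 0) *
          (((i : ℕ).choose t : ℝ) * q ^ (k + t - i) * p ^ ((i : ℕ) - t)) := by
    rw [truncBinomMatrix_apply]
    push_cast
    rfl
  rw [h1, h2, ← Finset.sum_sub_distrib]
  refine (Finset.abs_sum_le_sum_abs _ _).trans ?_
  have h3 : ∀ t ∈ Finset.range (k + 1),
      |(Q : ℝ) ^ (r : ℕ) / (Q : ℝ) ^ t *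
          (((i : ℕ).choose t : ℝ) * q ^ (k + t - i) * p ^ ((i : ℕ) - t)) -
        (if t ≤ (r : ℕ) then (Q : ℝ) ^ ((r : ℕ) - t) else 0) *
          (((i : ℕ).choose t : ℝ) * q ^ (k + t - i) * p ^ ((i : ℕ) - t))| ≤
      ((i : ℕ).choose t : ℝ) * ((q : ℝ) ^ k / Q) := by
    intro t _
    rw [← sub_mul]
    rcases le_or_gt t (r : ℕ) with htr | htr
    · rw [if_pos htr, pow_sub₀ _ hQ0.ne' htr, div_eq_mul_inv, sub_self, zero_mul, abs_zero]
      positivity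
    rcases lt_or_ge (i : ℕ) t with hti | hti
    · simp [Nat.choose_eq_zero_of_lt hti]
    rw [if_neg (not_le.2 htr), sub_zero, abs_of_nonneg (by positivity)]
    have h4 : (Q : ℝ) ^ (r : ℕ) / (Q : ℝ) ^ t ≤ 1 / Q := by
      rw [div_le_div_iff₀ (by positivity) hQ0, one_mul, ← pow_succ]
      exact pow_le_pow_right₀ hQ1 htr
    have h5 : (q : ℝ) ^ (k + t - i) * p ^ ((i : ℕ) - t) ≤ q ^ k := by
      calc (q : ℝ) ^ (k + t - i) * p ^ ((i : ℕ) - t)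
          ≤ (q : ℝ) ^ (k + t - i) * q ^ ((i : ℕ) - t) := by gcongr
        _ = q ^ k := by
          rw [← pow_add]
          congr 1
          omega
    calc (Q : ℝ) ^ (r : ℕ) / (Q : ℝ) ^ t *
          (((i : ℕ).choose t : ℝ) * q ^ (k + t - i) * p ^ ((i : ℕ) - t))
        = (Q : ℝ) ^ (r : ℕ) / (Q : ℝ) ^ t *
          (((i : ℕ).choose t : ℝ) * (q ^ (k + t - i) * p ^ ((i : ℕ) - t))) := by ring
      _ ≤ 1 / Q * (((i : ℕ).choose t : ℝ) * q ^ k) := by gcongr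
      _ = ((i : ℕ).choose t : ℝ) * ((q : ℝ) ^ k / Q) := by ring
  refine (Finset.sum_le_sum h3).trans ?_
  rw [← hext _ (fun t ht => by simp [Nat.choose_eq_zero_of_lt ht]), ← Finset.sum_mul]
  have h6 : ∑ t ∈ Finset.range ((i : ℕ) + 1), ((i : ℕ).choose t : ℝ) = 2 ^ (i : ℕ) := by
    exact_mod_cast Nat.sum_range_choose (i : ℕ)
  rw [h6, mul_div_assoc]
  gcongr
  norm_num

/-- If `ζ` is very close to `p / b ^ A + 1 / b ^ B` then `(ζ, …, ζ ^ k)` has `m + 1` independent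
good approximations. -/
theorem hasIndepSolutions_of_approx {k m b A B D p : ℕ} (hk : 1 ≤ k) (hm : m ≤ k) (hb : 2 ≤ b)
    (hA : 1 ≤ A) (hp : p ≤ b ^ A) {ζ η : ℝ} (hζ : ζ ≤ 1)
    (h1 : (p : ℝ) / (b : ℝ) ^ A + 1 / (b : ℝ) ^ B ≤ ζ)
    (h2 : ζ - ((p : ℝ) / (b : ℝ) ^ A + 1 / (b : ℝ) ^ B) ≤ 2 * ((b : ℝ) ^ D)⁻¹)
    (hD : (m + 1) * B ≤ D) (hη : η * (k * A + m * B) ≤ B - (2 * k + 1) * A) :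
    HasIndepSolutions k (m + 1) (powerVec k ζ) η ((b : ℝ) ^ (k * A + m * B)) := by
  have hb1 : (1 : ℝ) ≤ b := by exact_mod_cast (by omega : 1 ≤ b)
  have hb2 : (2 : ℝ) ≤ b := by exact_mod_cast hb
  have hb0 : (0 : ℝ) < b := by linarith
  have hmk : m + 1 ≤ k + 1 := by omega
  let V := truncBinomMatrix k (b ^ A) (b ^ B) p
  have hV : LinearIndependent ℤ V.row := linearIndependent_truncBinomMatrix _ _ (by positivity)
  set z : ℝ := (p : ℝ) / (b : ℝ) ^ A + 1 / (b : ℝ) ^ B with hz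
  have hz0 : 0 ≤ z := by positivity
  refine ⟨fun s => V.row (Fin.castLE hmk s), hV.comp _ (Fin.castLE_injective hmk), fun s => ?_⟩
  have hV0 : (((V.row (Fin.castLE hmk s) 0) : ℤ) : ℝ) = ((b : ℝ) ^ A) ^ k * ((b : ℝ) ^ B) ^ (s : ℕ) := by
    simp [V, Matrix.row, truncBinomMatrix_zero]
  have hsm : (s : ℕ) ≤ m := by omega
  have hV1 : ((b : ℝ) ^ A) ^ k * ((b : ℝ) ^ B) ^ (s : ℕ) ≤ (b : ℝ) ^ (k * A + m * B) := by
    rw [← pow_mul, ← pow_mul, ← pow_add, mul_comm A, mul_comm B]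
    gcongr
  refine ⟨by rwa [hV0, abs_of_pos (by positivity)], fun i => ?_⟩
  rw [hV0]
  have e1 : |z ^ ((i : ℕ) + 1) * (((b : ℝ) ^ A) ^ k * ((b : ℝ) ^ B) ^ (s : ℕ)) -
      (V.row (Fin.castLE hmk s) i.succ : ℝ)| ≤ 2 ^ k * ((b : ℝ) ^ A) ^ k / (b : ℝ) ^ B := by
    have := abs_truncBinomMatrix_sub_le (k := k) (q := b ^ A) (Q := b ^ B) (p := p)
      (Nat.one_le_pow _ _ (by omega)) (Nat.one_le_pow _ _ (by omega)) hp (Fin.castLE hmk s) i.succ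
    push_cast at this
    exact this
  have hpow : 2 * (k : ℝ) ≤ 2 ^ k := by
    exact_mod_cast two_mul_le_two_pow hk
  have e2 : |(ζ ^ ((i : ℕ) + 1) - z ^ ((i : ℕ) + 1)) *
      (((b : ℝ) ^ A) ^ k * ((b : ℝ) ^ B) ^ (s : ℕ))| ≤ 2 ^ k * ((b : ℝ) ^ A) ^ k / (b : ℝ) ^ B := by
    have h3 := pow_sub_pow_le_mul_sub hz0 h1 hζ ((i : ℕ) + 1)
    have h4 : 0 ≤ ζ ^ ((i : ℕ) + 1) - z ^ ((i : ℕ) + 1) :=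
      sub_nonneg.2 (pow_le_pow_left₀ hz0 h1 _)
    have h5 : (((i : ℕ) + 1 : ℕ) : ℝ) ≤ k := by exact_mod_cast i.2
    rw [abs_of_nonneg (mul_nonneg h4 (by positivity))]
    calc (ζ ^ ((i : ℕ) + 1) - z ^ ((i : ℕ) + 1)) *
          (((b : ℝ) ^ A) ^ k * ((b : ℝ) ^ B) ^ (s : ℕ))
        ≤ (k * (2 * ((b : ℝ) ^ D)⁻¹)) * (((b : ℝ) ^ A) ^ k * ((b : ℝ) ^ B) ^ m) := by
          refine mul_le_mul (h3.trans ?_) ?_ (by positivity) (by positivity)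
          · exact mul_le_mul h5 h2 (by linarith) (by positivity)
          · gcongr
            exact one_le_pow₀ hb1
      _ = 2 * k * (((b : ℝ) ^ A) ^ k * ((b : ℝ) ^ B) ^ m) / (b : ℝ) ^ D := by ring
      _ ≤ 2 ^ k * (((b : ℝ) ^ A) ^ k * ((b : ℝ) ^ B) ^ m) / (b : ℝ) ^ ((m + 1) * B) := by gcongr
      _ = 2 ^ k * ((b : ℝ) ^ A) ^ k / (b : ℝ) ^ B := by
          rw [mul_comm (m + 1) B, pow_mul, pow_succ]
          field_simp
  -- The constants `2` and `2 ^ k` are absorbed by `b ^ A` and `(b ^ A) ^ k`, whence `2 * k + 1` in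
  -- `hη`.
  have e3 : 2 * (2 ^ k * ((b : ℝ) ^ A) ^ k / (b : ℝ) ^ B) ≤
      ((b : ℝ) ^ (k * A + m * B)) ^ (-η) := by
    have h3 : (2 : ℝ) ≤ (b : ℝ) ^ A := hb2.trans (le_self_pow₀ hb1 (by omega))
    calc 2 * (2 ^ k * ((b : ℝ) ^ A) ^ k / (b : ℝ) ^ B)
        ≤ (b : ℝ) ^ A * (((b : ℝ) ^ A) ^ k * ((b : ℝ) ^ A) ^ k / (b : ℝ) ^ B) := by gcongr
      _ = (b : ℝ) ^ ((2 * k + 1) * A) / (b : ℝ) ^ B := by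
          rw [mul_comm _ A, pow_mul]
          ring
      _ = (b : ℝ) ^ ((2 * k + 1) * A - B : ℝ) := by
          rw [Real.rpow_sub hb0, Real.rpow_natCast, ← Real.rpow_natCast b ((2 * k + 1) * A)]
          push_cast
          rfl
      _ ≤ ((b : ℝ) ^ (k * A + m * B)) ^ (-η) := by
          rw [← Real.rpow_natCast b (k * A + m * B), ← Real.rpow_mul hb0.le]
          apply Real.rpow_le_rpow_of_exponent_le hb1
          push_cast
          linarith
  have h3 : powerVec k ζ i * (((b : ℝ) ^ A) ^ k * ((b : ℝ) ^ B) ^ (s : ℕ)) -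
      (V.row (Fin.castLE hmk s) i.succ : ℝ) =
      (z ^ ((i : ℕ) + 1) * (((b : ℝ) ^ A) ^ k * ((b : ℝ) ^ B) ^ (s : ℕ)) -
        (V.row (Fin.castLE hmk s) i.succ : ℝ)) + (ζ ^ ((i : ℕ) + 1) - z ^ ((i : ℕ) + 1)) *
          (((b : ℝ) ^ A) ^ k * ((b : ℝ) ^ B) ^ (s : ℕ)) := by
    rw [powerVec]
    ring
  rw [h3]
  refine (abs_add_le _ _).trans ?_
  linarith

/-! ### Partial sums and tails of the series -/

/-- The numerator of the `n`-th partial sum of `∑ b ^ (-a l)` over the denominator `b ^ a n`. -/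
def partialNum (b : ℕ) (a : ℕ → ℕ) (n : ℕ) : ℕ := ∑ l ∈ Finset.range (n + 1), b ^ (a n - a l)

theorem partialNum_div {b : ℕ} {a : ℕ → ℕ} (hb : 2 ≤ b) (ha : StrictMono a) (n : ℕ) :
    (partialNum b a n : ℝ) / (b : ℝ) ^ a n = ∑ l ∈ Finset.range (n + 1), ((b : ℝ) ^ a l)⁻¹ := by
  have hb0 : (b : ℝ) ≠ 0 := by
    have : b ≠ 0 := by omega
    exact_mod_cast this
  rw [partialNum, Nat.cast_sum, Finset.sum_div]
  refine Finset.sum_congr rfl fun l hl => ?_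
  have h : a l ≤ a n := ha.monotone (by simpa [Nat.lt_succ_iff] using hl)
  rw [Nat.cast_pow, pow_sub₀ _ hb0 h]
  field_simp

/-- The last term is `b ^ 0 = 1` and all the others are divisible by `b`. -/
theorem coprime_partialNum {b : ℕ} {a : ℕ → ℕ} (ha : StrictMono a) (n : ℕ) :
    Nat.Coprime (partialNum b a n) b := by
  have h : b ∣ ∑ l ∈ Finset.range n, b ^ (a n - a l) :=
    Finset.dvd_sum fun l hl => dvd_pow_self b
      (Nat.sub_pos_of_lt (ha (Finset.mem_range.1 hl))).ne'
  obtain ⟨c, hc⟩ := h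
  rw [partialNum, Finset.sum_range_succ, hc, Nat.sub_self, pow_zero]
  simp

/-- Since `a (l + N) ≥ a N + l`, the tail is dominated by a geometric series of ratio `1 / 2`. -/
theorem sum_le_tsum_and_tsum_sub_le {b : ℕ} {a : ℕ → ℕ} (hb : 2 ≤ b) (ha : StrictMono a) (N : ℕ) :
    ∑ l ∈ Finset.range N, ((b : ℝ) ^ a l)⁻¹ ≤ ∑' l : ℕ, ((b : ℝ) ^ a l)⁻¹ ∧
      ∑' l : ℕ, ((b : ℝ) ^ a l)⁻¹ - ∑ l ∈ Finset.range N, ((b : ℝ) ^ a l)⁻¹ ≤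
        2 * ((b : ℝ) ^ a N)⁻¹ := by
  have hb2 : (2 : ℝ) ≤ b := by exact_mod_cast hb
  have hle : ∀ N l, ((b : ℝ) ^ a (l + N))⁻¹ ≤ ((b : ℝ) ^ a N)⁻¹ * (1 / 2) ^ l := by
    intro N l
    have h1 : a N + l ≤ a (l + N) := by
      induction l with
      | zero => simp
      | succ l ih =>
        have := ha (show l + N < l + 1 + N by omega)
        omega
    calc ((b : ℝ) ^ a (l + N))⁻¹ ≤ ((b : ℝ) ^ (a N + l))⁻¹ := by
          gcongr
          linarith
      _ = ((b : ℝ) ^ a N)⁻¹ * ((b : ℝ) ^ l)⁻¹ := by rw [pow_add, mul_inv]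
      _ ≤ ((b : ℝ) ^ a N)⁻¹ * (1 / 2) ^ l := by
          rw [one_div, inv_pow]
          gcongr
  have hg : ∀ N, HasSum (fun l : ℕ => ((b : ℝ) ^ a N)⁻¹ * (1 / 2 : ℝ) ^ l)
      (((b : ℝ) ^ a N)⁻¹ * 2) := fun N => hasSum_geometric_two.mul_left _
  have hs : ∀ N, Summable fun l => ((b : ℝ) ^ a (l + N))⁻¹ := fun N =>
    Summable.of_nonneg_of_le (fun l => by positivity) (hle N) (hg N).summable
  have hs0 : Summable fun l => ((b : ℝ) ^ a l)⁻¹ := hs 0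
  refine ⟨hs0.sum_le_tsum _ fun l _ => by positivity, ?_⟩
  rw [← hs0.sum_add_tsum_nat_add N, add_sub_cancel_left, mul_comm, ← (hg N).tsum_eq]
  exact (hs N).tsum_le_tsum (hle N) (hg N).summable

theorem tsum_inv_pow_le_one {b : ℕ} {a : ℕ → ℕ} (hb : 2 ≤ b) (ha_pos : ∀ l, 0 < a l)
    (ha : StrictMono a) : ∑' l : ℕ, ((b : ℝ) ^ a l)⁻¹ ≤ 1 := by
  have h := (sum_le_tsum_and_tsum_sub_le hb ha 0).2
  have hb2 : (2 : ℝ) ≤ b := by exact_mod_cast hb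
  have h1 : (2 : ℝ) ≤ (b : ℝ) ^ a 0 :=
    hb2.trans (le_self_pow₀ (by linarith) (ha_pos 0).ne')
  have h2 : 2 * ((b : ℝ) ^ a 0)⁻¹ ≤ 1 := by
    rw [← div_eq_mul_inv, div_le_one (by positivity)]
    exact h1
  simp only [Finset.range_zero, Finset.sum_empty, sub_zero] at h
  linarith

/-! ### The exponents of the series -/

theorem le_natCast_pow {b n E : ℕ} {X₀ : ℝ} (hb : 2 ≤ b) (hn : X₀ ≤ n) (h : n ≤ E) :
    X₀ ≤ (b : ℝ) ^ E := by
  have : n ≤ b ^ E := h.trans (Nat.lt_pow_self (by omega)).le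
  exact hn.trans (by exact_mod_cast this)

theorem le_lambdaExp {k m b : ℕ} {a : ℕ → ℕ} (hk : 1 ≤ k) (hm : m ≤ k) (hb : 2 ≤ b)
    (ha_pos : ∀ l, 0 < a l) (ha : StrictMono a)
    (H : ∀ M N : ℕ, ∃ n ≥ N, M * a n ≤ a (n + 1) ∧ M * a (n + 1) ≤ a (n + 2)) {η : ℝ}
    (hη : η * m < 1) :
    (η : EReal) ≤ lambdaExp k (m + 1) (∑' l : ℕ, ((b : ℝ) ^ a l)⁻¹) := by
  refine le_sSup ⟨η, fun X₀ => ?_, rfl⟩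
  have hpos : 0 < 1 - η * m := by linarith
  -- The requirement on `η` rearranges to `(2k + 1 + ηk) * a n ≤ (1 - ηm) * a (n + 1)`. The extra `k
  -- + 1` in `H` ensures `(m + 1) * a (n + 1) ≤ a (n + 2)`.
  obtain ⟨M, hM⟩ := exists_nat_ge ((2 * k + 1 + η * k) / (1 - η * m))
  obtain ⟨N, hN⟩ := exists_nat_ge X₀
  obtain ⟨n, hn, hn1, hn2⟩ := H (M + k + 1) N
  have hpn := partialNum_div hb ha n
  have hζ := tsum_inv_pow_le_one hb ha_pos ha
  have hz := sum_le_tsum_and_tsum_sub_le hb ha (n + 2)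
  have hz1 := (sum_le_tsum_and_tsum_sub_le hb ha (n + 1)).1
  rw [Finset.sum_range_succ, ← hpn, ← one_div] at hz
  rw [← hpn] at hz1
  have hbA : (0 : ℝ) < (b : ℝ) ^ a n := by
    have : 0 < b := by omega
    positivity
  have hp : partialNum b a n ≤ b ^ a n := by
    have h := (div_le_one hbA).1 (hz1.trans hζ)
    exact_mod_cast h
  have hna : n ≤ a n := ha.le_apply
  refine ⟨(b : ℝ) ^ (k * a n + m * a (n + 1)), ?_,
    hasIndepSolutions_of_approx hk hm hb (ha_pos n) hp hζ hz.1 hz.2 ?_ ?_⟩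
  · refine le_natCast_pow hb hN (hn.trans (hna.trans ?_))
    nlinarith
  · refine le_trans (Nat.mul_le_mul_right _ ?_) hn2
    omega
  · rw [div_le_iff₀ hpos] at hM
    have h1 : (((M + k + 1) * a n : ℕ) : ℝ) ≤ a (n + 1) := by exact_mod_cast hn1
    push_cast at h1
    have h2 : (M : ℝ) * a n ≤ a (n + 1) := by
      refine le_trans ?_ h1
      gcongr
      linarith [(Nat.cast_nonneg k : (0 : ℝ) ≤ k)]
    have h3 := mul_le_mul_of_nonneg_right hM (Nat.cast_nonneg (α := ℝ) (a n))
    have h4 := mul_le_mul_of_nonneg_left h2 hpos.le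
    linarith

/-- Solutions at a suitable level are proportional to the powers of a partial sum. -/
theorem mul_pow_eq_of_solution {k b n C : ℕ} {a : ℕ → ℕ} (hk : 1 ≤ k) (hb : 2 ≤ b)
    (ha_pos : ∀ l, 0 < a l) (ha : StrictMono a) {η : ℝ}
    (hC : (a n + 3 : ℝ) ≤ η * C) (hB : C + a n + k + 3 ≤ a (n + 1))
    {v : Fin (k + 1) → ℤ} (hx : |(v 0 : ℝ)| ≤ (b : ℝ) ^ C)
    (hy : ∀ i : Fin k, |powerVec k (∑' l : ℕ, ((b : ℝ) ^ a l)⁻¹) i * (v 0 : ℝ) - (v i.succ : ℝ)| ≤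
      ((b : ℝ) ^ C) ^ (-η)) (i : Fin (k + 1)) :
    v 0 * (partialNum b a n : ℤ) ^ (i : ℕ) = ((b : ℤ) ^ a n) ^ (i : ℕ) * v i := by
  have hz := sum_le_tsum_and_tsum_sub_le hb ha (n + 1)
  rw [← partialNum_div hb ha n] at hz
  exact mul_pow_eq_of_approx hk hb (tsum_inv_pow_le_one hb ha_pos ha) hz.1 hz.2 hC hB hx hy i

theorem lambdaHatExp_le_zero {k j b : ℕ} {a : ℕ → ℕ} (hk : 1 ≤ k) (hj : 2 ≤ j) (hb : 2 ≤ b)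
    (ha_pos : ∀ l, 0 < a l) (ha : StrictMono a)
    (H : ∀ M N : ℕ, ∃ n ≥ N, M * a n ≤ a (n + 1)) :
    lambdaHatExp k j (∑' l : ℕ, ((b : ℝ) ^ a l)⁻¹) ≤ 0 := by
  refine sSup_le ?_
  rintro _ ⟨η, ⟨X₀, hη⟩, rfl⟩
  rw [← EReal.coe_zero, EReal.coe_le_coe_iff]
  by_contra! hpos
  -- At height `b ^ (D * a n)` this gives `η * D * a n ≥ 4 * a n ≥ a n + 3`.
  obtain ⟨D, hD⟩ := exists_nat_ge (4 / η)
  rw [div_le_iff₀ hpos] at hD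
  have hD1 : 1 ≤ D := by
    rw [Nat.one_le_iff_ne_zero]
    rintro rfl
    simp only [Nat.cast_zero, zero_mul] at hD
    linarith
  obtain ⟨N, hN⟩ := exists_nat_ge X₀
  obtain ⟨n, hn, hn1⟩ := H (D + k + 4) N
  have hA := ha_pos n
  have hA1 : (1 : ℝ) ≤ a n := by exact_mod_cast hA
  have hna : n ≤ a n := ha.le_apply
  obtain ⟨v, hv, hs⟩ := hη ((b : ℝ) ^ (D * a n))
    (le_natCast_pow hb hN (hn.trans (hna.trans (Nat.le_mul_of_pos_left _ hD1))))
  have hC : (a n + 3 : ℝ) ≤ η * ((D * a n : ℕ) : ℝ) := by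
    push_cast
    nlinarith
  have hB : D * a n + a n + k + 3 ≤ a (n + 1) := by nlinarith
  have key := fun s => mul_pow_eq_of_solution hk hb ha_pos ha hC hB (hs s).1 (hs s).2
  let s₀ : Fin j := ⟨0, by omega⟩
  let s₁ : Fin j := ⟨1, by omega⟩
  have hpair : LinearIndependent ℤ ![v s₀, v s₁] := by
    have h := hv.comp ![s₀, s₁] (by
      intro x y hxy
      fin_cases x <;> fin_cases y <;> simp_all [s₀, s₁])
    convert h using 1
    funext i
    fin_cases i <;> rfl
  have hq : (b : ℤ) ^ a n ≠ 0 := pow_ne_zero _ (by omega)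
  -- Cross-multiplying the first coordinates of two proportional vectors is a linear relation, so
  -- these coordinates vanish, and then so does the vector `v s₁`.
  have hzero := LinearIndependent.pair_iff.1 hpair (v s₁ 0) (-v s₀ 0) (by
    ext i
    have h0 := key s₀ i
    have h1 := key s₁ i
    refine mul_left_cancel₀ (pow_ne_zero (i : ℕ) hq) ?_
    simp only [Pi.add_apply, Pi.smul_apply, smul_eq_mul, Pi.zero_apply, mul_zero]
    linear_combination (-v s₁ 0) * h0 + v s₀ 0 * h1)
  apply hv.ne_zero s₁
  ext i
  have h1 := key s₁ i
  rw [hzero.1, zero_mul] at h1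
  exact (mul_eq_zero.1 h1.symm).resolve_left (pow_ne_zero _ hq)

theorem lambdaHatExp_one_le {k b : ℕ} {a : ℕ → ℕ} (hk : 1 ≤ k) (hb : 2 ≤ b)
    (ha_pos : ∀ l, 0 < a l) (ha : StrictMono a)
    (H : ∀ M N : ℕ, ∃ n ≥ N, M * a n ≤ a (n + 1)) :
    lambdaHatExp k 1 (∑' l : ℕ, ((b : ℝ) ^ a l)⁻¹) ≤ ((1 / (k : ℝ) : ℝ) : EReal) := by
  refine sSup_le ?_
  rintro _ ⟨η, ⟨X₀, hη⟩, rfl⟩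
  rw [EReal.coe_le_coe_iff]
  by_contra! hlt
  have hk0 : (0 : ℝ) < k := by exact_mod_cast hk
  rw [div_lt_iff₀ hk0] at hlt
  have hpos : 0 < η * k - 1 := by linarith
  -- For `C = k * a n - 1` the condition `a n + 3 ≤ η * C` reads `3 + η ≤ (η k - 1) * a n`.
  obtain ⟨N₁, hN₁⟩ := exists_nat_ge ((3 + η) / (η * k - 1))
  rw [div_le_iff₀ hpos] at hN₁
  obtain ⟨N₂, hN₂⟩ := exists_nat_ge X₀
  obtain ⟨n, hn, hn1⟩ := H (2 * k + 3) (N₁ + N₂ + 1)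
  have hA := ha_pos n
  have hna : n ≤ a n := ha.le_apply
  have hkA : a n ≤ k * a n := Nat.le_mul_of_pos_left _ hk
  -- The largest exponent with `b ^ C < q ^ k`, where `q = b ^ a n`: divisibility of `x` by `q ^ k`
  -- then forces `x = 0`.
  obtain ⟨C, hC⟩ : ∃ C, k * a n = C + 1 := ⟨k * a n - 1, by omega⟩
  obtain ⟨v, hv, hs⟩ := hη ((b : ℝ) ^ C) (le_natCast_pow hb hN₂ (by omega))
  have hCR : (k * a n : ℝ) = C + 1 := by exact_mod_cast hC
  have hC' : (a n + 3 : ℝ) ≤ η * C := by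
    have h1 : (N₁ : ℝ) ≤ a n := by exact_mod_cast (by omega : N₁ ≤ a n)
    have h2 := mul_le_mul_of_nonneg_right h1 hpos.le
    have h3 : η * (k * a n) = η * C + η := by rw [hCR]; ring
    nlinarith
  have hB : C + a n + k + 3 ≤ a (n + 1) := by nlinarith
  have key := mul_pow_eq_of_solution hk hb ha_pos ha hC' hB (hs 0).1 (hs 0).2
  have hq : (b : ℤ) ^ a n ≠ 0 := pow_ne_zero _ (by omega)
  have hcop : IsCoprime (((b : ℤ) ^ a n) ^ k) ((partialNum b a n : ℤ) ^ k) :=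
    (Nat.isCoprime_iff_coprime.2 (coprime_partialNum ha n)).symm.pow_left.pow
  have hlast := key (Fin.last k)
  rw [Fin.val_last] at hlast
  have hdvd : ((b : ℤ) ^ a n) ^ k ∣ v 0 0 := hcop.dvd_of_dvd_mul_right ⟨_, hlast⟩
  have hx : v 0 0 = 0 := by
    refine Int.eq_zero_of_abs_lt_dvd hdvd ?_
    have h1 : |v 0 0| ≤ (b : ℤ) ^ C := by exact_mod_cast (hs 0).1
    refine h1.trans_lt ?_
    rw [← pow_mul, mul_comm, hC]
    exact pow_lt_pow_right₀ (by omega) (by omega)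
  apply hv.ne_zero 0
  ext i
  have h1 := key i
  rw [hx, zero_mul] at h1
  exact (mul_eq_zero.1 h1.symm).resolve_left (pow_ne_zero _ hq)

theorem mainTheorem5 (k : ℕ) (hk : 1 ≤ k) (a : ℕ → ℕ) (ha_pos : ∀ l, 0 < a l)
    (ha : StrictMono a)
    (hlim : limsup (fun n : ℕ =>
      ((min ((a (n + 1) : ℝ) / (a n : ℝ)) ((a (n + 2) : ℝ) / (a (n + 1) : ℝ)) : ℝ) : EReal))
        atTop = ⊤)
    (b : ℕ) (hb : 2 ≤ b) (ζ : ℝ) (hζ : ζ = ∑' l : ℕ, ((b : ℝ) ^ (a l))⁻¹) :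
    lambdaExp k 1 ζ = ⊤ ∧
    (∀ j : ℕ, 2 ≤ j → j ≤ k + 1 → lambdaExp k j ζ = ((1 / ((j : ℝ) - 1) : ℝ) : EReal)) ∧
    lambdaHatExp k 1 ζ = ((1 / (k : ℝ) : ℝ) : EReal) ∧
    (∀ j : ℕ, 2 ≤ j → j ≤ k + 1 → lambdaHatExp k j ζ = 0) := by
  subst hζ
  have H : ∀ M N : ℕ, ∃ n ≥ N, M * a n ≤ a (n + 1) ∧ M * a (n + 1) ≤ a (n + 2) := by
    intro M N
    have hfreq := frequently_lt_of_lt_limsup (b := ((M : ℝ) : EReal)) (by isBoundedDefault)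
      (hlim ▸ EReal.coe_lt_top _)
    obtain ⟨n, hn, h⟩ := frequently_atTop.1 hfreq N
    rw [EReal.coe_lt_coe_iff, lt_min_iff] at h
    have h0 : ∀ l, (0 : ℝ) < a l := fun l => by exact_mod_cast ha_pos l
    rw [lt_div_iff₀ (h0 _), lt_div_iff₀ (h0 _)] at h
    exact ⟨n, hn, by exact_mod_cast h.1.le, by exact_mod_cast h.2.le⟩
  have H' : ∀ M N : ℕ, ∃ n ≥ N, M * a n ≤ a (n + 1) := fun M N =>
    (H M N).imp fun n h => ⟨h.1, h.2.1⟩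
  refine ⟨?_, ?_, ?_, ?_⟩
  · rw [EReal.eq_top_iff_forall_lt]
    intro y
    refine lt_of_lt_of_le (EReal.coe_lt_coe_iff.2 (lt_of_le_of_lt (le_abs_self y) (lt_add_one _)))
      (le_lambdaExp (m := 0) hk (by omega) hb ha_pos ha H (η := |y| + 1) (by simp))
  · intro j hj hjk
    obtain ⟨m, rfl⟩ : ∃ m, j = m + 1 := ⟨j - 1, by omega⟩
    have hm0 : (0 : ℝ) < m := by exact_mod_cast (by omega : 0 < m)
    rw [show (((m + 1 : ℕ) : ℝ) - 1) = m by push_cast; ring]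
    refine le_antisymm (lambdaVec_le k m (by omega) _) ?_
    refine EReal.ge_of_forall_gt_iff_ge.1 fun c hc => ?_
    rw [EReal.coe_lt_coe_iff] at hc
    refine (EReal.coe_le_coe_iff.2 (le_max_left c 0)).trans
      (le_lambdaExp hk (by omega) hb ha_pos ha H ?_)
    rw [← lt_div_iff₀ hm0]
    exact max_lt hc (by positivity)
  · exact le_antisymm (lambdaHatExp_one_le hk hb ha_pos ha H') (le_lambdaHatVec_one hk _)
  · intro j hj hjk
    exact le_antisymm (lambdaHatExp_le_zero hk hj hb ha_pos ha H') (lambdaHatVec_nonneg hjk _)
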